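/- **Setting.** Let $X$ be a non-empty compact Hausdorff space and $A\subseteq C(X)=C(X,\mathbb C)$ a uniform algebra on $X$, i.e. a subalgebra that contains the constants, is closed in the supremum norm $\|\cdot\|_\infty$ (which is the norm of $A$) and separates the points of $X$. Assume that $A$ is natural on $X$: every character of $A$ is evaluation at a point of $X$. Let $\alpha(x)=a_0+a_1x+\cdots+a_{n-1}x^{n-1}+x^n\in A[x]$ be a monic polynomial of degree $n\ge 1$, and let $d=\operatorname{discr}(\alpha)\in A$ be its discriminant. * The *Arens–Hoffman extension* is $B=A[x]/(\alpha(x))$ with the embedding $\nu'\colon a\mapsto (\alpha(x))+a$ and the norm $\|(\alpha(x))+\delta(x)\|=\inf_{\gamma\in A[x]}\|\gamma(x)\alpha(x)+\delta(x)\|_t$, where $\big\|\sum_k c_kx^k\big\|_t=\sum_k\|c_k\|_\infty t^k$ and $t>0$ is any number with $\sum_{k=0}^{n-1}\|a_k\|_\infty t^k\le t^n$. * The *Cole extension* $A^\alpha$ is the closed subalgebra of $C(X^\alpha)$ generated by $\{f\circ\pi: f\in A\}\cup\{p_\alpha\}$, where $X^\alpha=\{(\kappa,\lambda)\in X\times\mathbb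 C:\ a_0(\kappa)+\cdots+a_{n-1}(\kappa)\lambda^{n-1}+\lambda^n=0\}$, $\pi(\kappa,\lambda)=\kappa$ and $p_\alpha(\kappa,\lambda)=\lambda$; its norm is the supremum norm and its embedding is $\pi^*\colon A\to A^\alpha$, $f\mapsto f\circ\pi$. * $d$ is a *topological zero divisor* of $A$ if there is a sequence $(u_m)$ in $A$ with $\|u_m\|_\infty=1$ for all $m$ and $u_md\to0$. **Theorem 4.12.** If $d$ is not a topological zero divisor of $A$, then, for every admissible $t$, $B$ and $A^\alpha$ are topologically isomorphic extensions of $A$: $\nu'$ and $\pi^*$ are continuous unital monomorphisms, and there is a unital algebra isomorphism $\phi\colon B\to A^\alpha$ which is a homeomorphism and satisfies $\phi\circ\nu'=\pi^*$. For example, let $A_\Delta$ be the disc algebra (the continuous functions on the closed unit disc $\Delta$ that are analytic in its interior), let $z\in A_\Delta$ be the coordinate function and let $\alpha(x)=x^2-z$. Then $A_\Delta$ is a natural uniform algebra on $\Delta$, $\operatorname{discr}(\alpha)=4z$ is not a topological zero divisor, and the Arens–Hoffman extension (for every admissible $t$) and the Cole extension of $A_\Delta$ by $\alpha$ are topologically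 isomorphic extensions of $A_\Delta$. -/

import Mathlib

open Polynomial Topology

/-! ### Topologically isomorphic extensions -/

/-- Given unital normed complex algebras, (unital) extensions `θ₁ : A₁ → B₁`, `θ₂ : A₂ → B₂` and an
isomorphism `φ₀ : A₁ → A₂`, the extensions are topologically isomorphic (along `φ₀`) if `θ₁`, `θ₂`
are continuous monomorphisms, `φ₀` is a homeomorphism and there is a unital algebra isomorphism
`φ : B₁ → B₂` which is a homeomorphism and satisfies `φ ∘ θ₁ = θ₂ ∘ φ₀`. -/
def IsTopologicallyIsomorphicExtension {A₁ A₂ B₁ B₂ : Type*}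
    [NormedCommRing A₁] [NormedAlgebra ℂ A₁] [NormedCommRing A₂] [NormedAlgebra ℂ A₂]
    [NormedCommRing B₁] [NormedAlgebra ℂ B₁] [NormedCommRing B₂] [NormedAlgebra ℂ B₂]
    (φ₀ : A₁ ≃ₐ[ℂ] A₂) (θ₁ : A₁ →ₐ[ℂ] B₁) (θ₂ : A₂ →ₐ[ℂ] B₂) : Prop :=
  Continuous φ₀ ∧ Continuous φ₀.symm ∧
  Function.Injective θ₁ ∧ Continuous θ₁ ∧ Function.Injective θ₂ ∧ Continuous θ₂ ∧
  ∃ φ : B₁ ≃ₐ[ℂ] B₂, Continuous φ ∧ Continuous φ.symm ∧ ∀ a, φ (θ₁ a) = θ₂ (φ₀ a)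

/-- `a` is a topological zero divisor: `uₙ a → 0` for some sequence of elements `uₙ` of norm one. -/
def IsTopologicalZeroDivisor {A : Type*} [NormedCommRing A] (a : A) : Prop :=
  ∃ u : ℕ → A, (∀ n, ‖u n‖ = 1) ∧ Filter.Tendsto (fun n => u n * a) Filter.atTop (𝓝 0)

/-! ### Uniform algebras -/

/-- A uniform algebra on `X`: a uniformly closed unital subalgebra of `C(X, ℂ)` that separates the
points of `X`. It carries the supremum norm. -/
structure IsUniformAlgebra {X : Type*} [TopologicalSpace X] [CompactSpace X]
    (A : Subalgebra ℂ C(X, ℂ)) : Prop where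
  isClosed : IsClosed (A : Set C(X, ℂ))
  separatesPoints : A.SeparatesPoints

/-- The character `f ↦ f x` of a function algebra `A` on `X`. -/
noncomputable def pointEval {X : Type*} [TopologicalSpace X]
    (A : Subalgebra ℂ C(X, ℂ)) (x : X) : A →ₐ[ℂ] ℂ :=
  (ContinuousMap.evalAlgHom ℂ ℂ x).comp A.val

/-- `A` is natural on `X`: every (continuous) character of `A` is evaluation at a point of `X`. -/
def IsNatural {X : Type*} [TopologicalSpace X] [CompactSpace X]
    (A : Subalgebra ℂ C(X, ℂ)) : Prop :=
  ∀ ω : WeakDual.characterSpace ℂ A, ∃ x : X, ∀ f : A, ω f = pointEval A x f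

/-! ### Arens–Hoffman extensions -/

section ArensHoffman

variable {A : Type*} [NormedCommRing A]

/-- `t` is an admissible parameter of an Arens–Hoffman norm for the (monic) polynomial
`α = a₀ + ⋯ + aₙ₋₁ xⁿ⁻¹ + xⁿ`: `t > 0` and `‖a₀‖ + ‖a₁‖ t + ⋯ + ‖aₙ₋₁‖ tⁿ⁻¹ ≤ tⁿ`. -/
structure IsArensHoffmanParameter (α : A[X]) (t : ℝ) : Prop where
  monic : α.Monic
  pos : 0 < t
  sum_le : ∑ k ∈ Finset.range α.natDegree, ‖α.coeff k‖ * t ^ k ≤ t ^ α.natDegree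

/-- The norm `‖c₀ + ⋯ + c_p x^p‖ = ∑ ‖c_k‖ t^k` on `A[x]`. -/
noncomputable def arensHoffmanPolyNorm (t : ℝ) (γ : A[X]) : ℝ :=
  ∑ k ∈ γ.support, ‖γ.coeff k‖ * t ^ k

/-- The Arens–Hoffman extension `A[x]/(α)` with norm parameter `t`. -/
def ArensHoffmanExtension (α : A[X]) (t : ℝ) (_ht : IsArensHoffmanParameter α t) : Type _ :=
  AdjoinRoot α

/-- The quotient norm on `A[x]/(α)`: the infimum of the norms of the representatives. -/
noncomputable def arensHoffmanNorm (α : A[X]) (t : ℝ) (b : AdjoinRoot α) : ℝ :=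
  sInf (arensHoffmanPolyNorm t '' {γ : A[X] | AdjoinRoot.mk α γ = b})

/- Facts needed to see that the quotient norm is an algebra norm. -/

theorem arensHoffmanPolyNorm_eq (t : ℝ) (γ : A[X]) {M : ℕ} (hM : γ.natDegree < M) :
    arensHoffmanPolyNorm t γ = ∑ k ∈ Finset.range M, ‖γ.coeff k‖ * t ^ k := by
  refine Finset.sum_subset (fun k hk => ?_) (fun k _ hk => ?_)
  · exact Finset.mem_range.2 ((le_natDegree_of_mem_supp k hk).trans_lt hM)
  · simp [notMem_support_iff.1 hk]

theorem arensHoffmanPolyNorm_nonneg {t : ℝ} (ht : 0 < t) (γ : A[X]) :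
    0 ≤ arensHoffmanPolyNorm t γ :=
  Finset.sum_nonneg fun _ _ => by positivity

theorem arensHoffmanPolyNorm_zero (t : ℝ) : arensHoffmanPolyNorm t (0 : A[X]) = 0 := by
  simp [arensHoffmanPolyNorm]

theorem arensHoffmanPolyNorm_neg (t : ℝ) (γ : A[X]) :
    arensHoffmanPolyNorm t (-γ) = arensHoffmanPolyNorm t γ := by
  simp [arensHoffmanPolyNorm]

theorem arensHoffmanPolyNorm_add {t : ℝ} (ht : 0 < t) (γ δ : A[X]) :
    arensHoffmanPolyNorm t (γ + δ) ≤ arensHoffmanPolyNorm t γ + arensHoffmanPolyNorm t δ := by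
  have h := natDegree_add_le γ δ
  have h1 := le_max_left γ.natDegree δ.natDegree
  have h2 := le_max_right γ.natDegree δ.natDegree
  rw [arensHoffmanPolyNorm_eq t (γ + δ) (Nat.lt_succ_of_le h),
    arensHoffmanPolyNorm_eq t γ (Nat.lt_succ_of_le h1),
    arensHoffmanPolyNorm_eq t δ (Nat.lt_succ_of_le h2), ← Finset.sum_add_distrib]
  refine Finset.sum_le_sum fun k _ => ?_
  rw [coeff_add, ← add_mul]
  gcongr
  exact norm_add_le _ _

theorem arensHoffmanPolyNorm_monomial (t : ℝ) (k : ℕ) (a : A) :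
    arensHoffmanPolyNorm t (monomial k a) = ‖a‖ * t ^ k := by
  rw [arensHoffmanPolyNorm_eq t _ (Nat.lt_succ_of_le (natDegree_monomial_le a)),
    Finset.sum_eq_single k]
  · simp
  · intro j _ hj
    simp [coeff_monomial_of_ne a hj]
  · simp

theorem arensHoffmanPolyNorm_mul {t : ℝ} (ht : 0 < t) (γ δ : A[X]) :
    arensHoffmanPolyNorm t (γ * δ) ≤ arensHoffmanPolyNorm t γ * arensHoffmanPolyNorm t δ := by
  have hsub := fun (s : Finset ℕ) (g : ℕ → A[X]) =>
    Finset.le_sum_of_subadditive (arensHoffmanPolyNorm (A := A) t) (arensHoffmanPolyNorm_zero t).le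
      (arensHoffmanPolyNorm_add ht) s g
  rw [mul_eq_sum_sum]
  refine (hsub _ _).trans ?_
  simp only [arensHoffmanPolyNorm, Polynomial.sum]
  rw [Finset.sum_mul_sum]
  refine Finset.sum_le_sum fun i _ => (hsub _ _).trans (Finset.sum_le_sum fun j _ => ?_)
  rw [arensHoffmanPolyNorm_monomial, pow_add]
  calc ‖γ.coeff i * δ.coeff j‖ * (t ^ i * t ^ j)
      ≤ (‖γ.coeff i‖ * ‖δ.coeff j‖) * (t ^ i * t ^ j) := by
        gcongr
        exact norm_mul_le _ _
    _ = _ := by ring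

theorem arensHoffmanPolyNorm_eq_zero {t : ℝ} (ht : 0 < t) {γ : A[X]}
    (h : arensHoffmanPolyNorm t γ = 0) : γ = 0 := by
  ext k
  by_contra hk
  have hk' : k ∈ γ.support := mem_support_iff.2 hk
  have := (Finset.sum_eq_zero_iff_of_nonneg (fun _ _ => by positivity)).1 h k hk'
  simp only [mul_eq_zero, norm_eq_zero, pow_eq_zero_iff', ht.ne', false_and, or_false] at this
  exact hk this

theorem arensHoffmanPolyNorm_add_X_pow_mul (t : ℝ) {n : ℕ} {β : A[X]}
    (hβ : ∀ k, n ≤ k → β.coeff k = 0) (γ : A[X]) :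
    arensHoffmanPolyNorm t (β + X ^ n * γ) =
      arensHoffmanPolyNorm t β + t ^ n * arensHoffmanPolyNorm t γ := by
  have hβd : β.natDegree ≤ n := natDegree_le_iff_coeff_eq_zero.2 fun k hk => hβ k hk.le
  have hβM : β.natDegree < n + (γ.natDegree + 1) := by omega
  have hd : (β + X ^ n * γ).natDegree < n + (γ.natDegree + 1) := by
    refine (natDegree_add_le _ _).trans_lt (max_lt hβM ?_)
    refine natDegree_mul_le.trans_lt ?_
    have := natDegree_X_pow_le (R := A) n
    omega
  have hβ0 : ∑ k ∈ Finset.range (γ.natDegree + 1), ‖β.coeff (n + k)‖ * t ^ (n + k) = 0 :=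
    Finset.sum_eq_zero fun k _ => by simp [hβ (n + k) (Nat.le_add_right _ _)]
  rw [arensHoffmanPolyNorm_eq t _ hd, arensHoffmanPolyNorm_eq t _ hβM,
    arensHoffmanPolyNorm_eq t γ (Nat.lt_succ_self γ.natDegree),
    Finset.sum_range_add _ n (γ.natDegree + 1), Finset.sum_range_add _ n (γ.natDegree + 1),
    hβ0, add_zero, Finset.mul_sum]
  congr 1
  · refine Finset.sum_congr rfl fun k hk => ?_
    have : ¬ n ≤ k := by simpa using hk
    simp [coeff_X_pow_mul', this]
  · refine Finset.sum_congr rfl fun k _ => ?_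
    rw [coeff_add, hβ (n + k) (Nat.le_add_right _ _), zero_add, add_comm n k, coeff_X_pow_mul,
      pow_add]
    ring

theorem arensHoffmanPolyNorm_le {α : A[X]} {t : ℝ} (h : IsArensHoffmanParameter α t) {β : A[X]}
    (hβ : ∀ k, α.natDegree ≤ k → β.coeff k = 0) (γ : A[X]) :
    arensHoffmanPolyNorm t β ≤ arensHoffmanPolyNorm t (β + α * γ) := by
  have hα : α = X ^ α.natDegree + (α - X ^ α.natDegree) := by ring
  have hlow : arensHoffmanPolyNorm t (α - X ^ α.natDegree) ≤ t ^ α.natDegree := by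
    have hd : (α - X ^ α.natDegree).natDegree < α.natDegree + 1 := by
      refine Nat.lt_succ_of_le ((natDegree_sub_le _ _).trans (max_le le_rfl ?_))
      exact natDegree_X_pow_le _
    rw [arensHoffmanPolyNorm_eq t _ hd, Finset.sum_range_succ]
    refine le_trans (le_of_eq ?_) h.sum_le
    have h0 : (α - X ^ α.natDegree).coeff α.natDegree = 0 := by
      simp [coeff_sub, h.monic.coeff_natDegree]
    rw [h0, norm_zero, zero_mul, add_zero]
    refine Finset.sum_congr rfl fun k hk => ?_
    have : k ≠ α.natDegree := (Finset.mem_range.1 hk).ne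
    simp [coeff_sub, coeff_X_pow, this]
  have h1 : β + X ^ α.natDegree * γ = (β + α * γ) + -((α - X ^ α.natDegree) * γ) := by ring
  have h2 := arensHoffmanPolyNorm_add h.pos (β + α * γ) (-((α - X ^ α.natDegree) * γ))
  rw [← h1, arensHoffmanPolyNorm_add_X_pow_mul t hβ, arensHoffmanPolyNorm_neg] at h2
  have h3 := arensHoffmanPolyNorm_mul h.pos (α - X ^ α.natDegree) γ
  have h4 := mul_le_mul_of_nonneg_right hlow (arensHoffmanPolyNorm_nonneg h.pos γ)
  linarith

/-- The infimum is attained at the representative of degree less than that of `α`. -/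
theorem arensHoffmanNorm_mk {α : A[X]} {t : ℝ} (h : IsArensHoffmanParameter α t) (δ : A[X]) :
    arensHoffmanNorm α t (AdjoinRoot.mk α δ) = arensHoffmanPolyNorm t (δ %ₘ α) := by
  have hcoeff : ∀ k, α.natDegree ≤ k → (δ %ₘ α).coeff k = 0 := by
    intro k hk
    nontriviality A
    refine coeff_eq_zero_of_degree_lt ((degree_modByMonic_lt δ h.monic).trans_le ?_)
    exact degree_le_natDegree.trans (by exact_mod_cast hk)
  refine IsLeast.csInf_eq ⟨⟨δ %ₘ α, ?_, rfl⟩, ?_⟩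
  · refine AdjoinRoot.mk_eq_mk.2 ⟨-(δ /ₘ α), ?_⟩
    have := modByMonic_add_div δ α
    linear_combination this
  · rintro _ ⟨γ, hγ, rfl⟩
    obtain ⟨q, hq⟩ := AdjoinRoot.mk_eq_mk.1 hγ
    have : γ = δ %ₘ α + α * (δ /ₘ α + q) := by
      have := modByMonic_add_div δ α
      linear_combination hq - this
    rw [this]
    exact arensHoffmanPolyNorm_le h hcoeff _

theorem arensHoffmanNorm_mk_le {α : A[X]} {t : ℝ} (h : IsArensHoffmanParameter α t) (δ : A[X]) :
    arensHoffmanNorm α t (AdjoinRoot.mk α δ) ≤ arensHoffmanPolyNorm t δ :=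
  csInf_le ⟨0, by rintro _ ⟨γ, _, rfl⟩; exact arensHoffmanPolyNorm_nonneg h.pos γ⟩ ⟨δ, rfl, rfl⟩

theorem exists_arensHoffmanNorm_eq {α : A[X]} {t : ℝ} (h : IsArensHoffmanParameter α t)
    (b : AdjoinRoot α) :
    ∃ γ : A[X], AdjoinRoot.mk α γ = b ∧ arensHoffmanNorm α t b = arensHoffmanPolyNorm t γ := by
  obtain ⟨δ, rfl⟩ := AdjoinRoot.mk_surjective b
  refine ⟨δ %ₘ α, ?_, arensHoffmanNorm_mk h δ⟩
  refine AdjoinRoot.mk_eq_mk.2 ⟨-(δ /ₘ α), ?_⟩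
  have := modByMonic_add_div δ α
  linear_combination this

noncomputable instance {α : A[X]} {t : ℝ} (h : IsArensHoffmanParameter α t) :
    CommRing (ArensHoffmanExtension α t h) :=
  inferInstanceAs (CommRing (AdjoinRoot α))

noncomputable instance [NormedAlgebra ℂ A] {α : A[X]} {t : ℝ} (h : IsArensHoffmanParameter α t) :
    Algebra ℂ (ArensHoffmanExtension α t h) :=
  inferInstanceAs (Algebra ℂ (AdjoinRoot α))

/-- The Arens–Hoffman extension as a ring normed by the quotient norm. -/
noncomputable instance {α : A[X]} {t : ℝ} (h : IsArensHoffmanParameter α t) :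
    NormedCommRing (ArensHoffmanExtension α t h) :=
  { (inferInstance : CommRing (ArensHoffmanExtension α t h)),
    AddGroupNorm.toNormedAddCommGroup (E := ArensHoffmanExtension α t h)
      { toFun := arensHoffmanNorm α t
        map_zero' := by
          have h1 : arensHoffmanNorm α t (AdjoinRoot.mk α 0) ≤ 0 :=
            (arensHoffmanNorm_mk_le h 0).trans (arensHoffmanPolyNorm_zero t).le
          have h2 : 0 ≤ arensHoffmanNorm α t (AdjoinRoot.mk α 0) := by
            rw [arensHoffmanNorm_mk h]
            exact arensHoffmanPolyNorm_nonneg h.pos _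
          have h3 := le_antisymm h1 h2
          rwa [map_zero] at h3
        add_le' := by
          intro x y
          obtain ⟨γ, hγ, hx⟩ := exists_arensHoffmanNorm_eq h x
          obtain ⟨δ, hδ, hy⟩ := exists_arensHoffmanNorm_eq h y
          rw [hx, hy]
          refine le_trans ?_ (arensHoffmanPolyNorm_add h.pos γ δ)
          have := arensHoffmanNorm_mk_le h (γ + δ)
          rw [map_add, hγ, hδ] at this
          exact this
        neg' := by
          have key : ∀ x : AdjoinRoot α, arensHoffmanNorm α t (-x) ≤ arensHoffmanNorm α t x := by
            intro x
            obtain ⟨γ, hγ, hx⟩ := exists_arensHoffmanNorm_eq h x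
            rw [hx, ← arensHoffmanPolyNorm_neg]
            have := arensHoffmanNorm_mk_le h (-γ)
            rw [map_neg, hγ] at this
            exact this
          have key' : ∀ x : AdjoinRoot α, arensHoffmanNorm α t (-x) = arensHoffmanNorm α t x := by
            intro x
            refine le_antisymm (key x) ?_
            have := key (-x)
            rwa [neg_neg] at this
          exact key'
        eq_zero_of_map_eq_zero' := by
          intro x hx
          obtain ⟨γ, hγ, hx'⟩ := exists_arensHoffmanNorm_eq h x
          have h0 : γ = 0 := arensHoffmanPolyNorm_eq_zero h.pos (hx'.symm.trans hx)
          rw [h0, map_zero] at hγ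
          exact hγ.symm } with
    norm_mul_le := by
      intro x y
      obtain ⟨γ, hγ, hx⟩ := exists_arensHoffmanNorm_eq h x
      obtain ⟨δ, hδ, hy⟩ := exists_arensHoffmanNorm_eq h y
      change arensHoffmanNorm α t _ ≤ arensHoffmanNorm α t x * arensHoffmanNorm α t y
      rw [hx, hy]
      refine le_trans ?_ (arensHoffmanPolyNorm_mul h.pos γ δ)
      have := arensHoffmanNorm_mk_le h (γ * δ)
      rw [map_mul, hγ, hδ] at this
      exact this }

theorem ArensHoffmanExtension.norm_def {α : A[X]} {t : ℝ} (h : IsArensHoffmanParameter α t)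
    (b : ArensHoffmanExtension α t h) : ‖b‖ = arensHoffmanNorm α t b := rfl

variable [NormedAlgebra ℂ A]

noncomputable instance {α : A[X]} {t : ℝ} (h : IsArensHoffmanParameter α t) :
    NormedAlgebra ℂ (ArensHoffmanExtension α t h) where
  norm_smul_le := by
    intro c x
    obtain ⟨γ, hγ, hx⟩ := exists_arensHoffmanNorm_eq h x
    rw [ArensHoffmanExtension.norm_def, ArensHoffmanExtension.norm_def, hx]
    have h1 := arensHoffmanNorm_mk_le h (c • γ)
    rw [← AdjoinRoot.smul_mk, hγ] at h1
    refine h1.trans ?_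
    have hs : (c • γ).natDegree < γ.natDegree + 1 :=
      Nat.lt_succ_of_le (natDegree_smul_le c γ)
    rw [arensHoffmanPolyNorm_eq t _ hs, arensHoffmanPolyNorm_eq t γ (Nat.lt_succ_self _),
      Finset.mul_sum]
    refine le_of_eq (Finset.sum_congr rfl fun k _ => ?_)
    rw [coeff_smul, norm_smul, mul_assoc]

/-- The canonical embedding `a ↦ a + (α)` of `A` into its Arens–Hoffman extension. -/
noncomputable def arensHoffmanEmbedding (α : A[X]) (t : ℝ) (h : IsArensHoffmanParameter α t) :
    A →ₐ[ℂ] ArensHoffmanExtension α t h :=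
  (AdjoinRoot.ofAlgHom ℂ α : A →ₐ[ℂ] AdjoinRoot α)

end ArensHoffman

/-! ### Simple Cole extensions -/

section Cole

variable {X : Type*} [TopologicalSpace X] [CompactSpace X] {A : Subalgebra ℂ C(X, ℂ)}

/-- `X^α = {(κ, z) ∈ X × ℂ : a₀(κ) + ⋯ + aₙ₋₁(κ) zⁿ⁻¹ + zⁿ = 0}` for a monic polynomial `α` over a
function algebra on `X`. -/
def ColeSpace (α : A[X]) (_hα : α.Monic) : Set (X × ℂ) :=
  {y | ∑ k ∈ Finset.range (α.natDegree + 1), (α.coeff k : C(X, ℂ)) y.1 * y.2 ^ k = 0}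

theorem norm_le_of_sum_eq_zero {n : ℕ} {c : ℕ → ℂ} {B : ℕ → ℝ} {z : ℂ} (hc : ∀ k, ‖c k‖ ≤ B k)
    (hz : ∑ k ∈ Finset.range n, c k * z ^ k + z ^ n = 0) :
    ‖z‖ ≤ max 1 (∑ k ∈ Finset.range n, B k) := by
  rcases le_or_gt ‖z‖ 1 with h1 | h1
  · exact h1.trans (le_max_left _ _)
  refine le_max_of_le_right ?_
  have h2 : ‖z‖ ^ n ≤ ∑ k ∈ Finset.range n, B k * ‖z‖ ^ k := by
    rw [← norm_pow, eq_neg_of_add_eq_zero_right hz, norm_neg]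
    refine (norm_sum_le _ _).trans (Finset.sum_le_sum fun k _ => ?_)
    rw [norm_mul, norm_pow]
    gcongr
    exact hc k
  have hpos : 0 < ‖z‖ := by linarith
  cases n with
  | zero => simp at hz
  | succ m =>
    refine le_of_mul_le_mul_right ?_ (pow_pos hpos m)
    rw [Finset.sum_mul]
    calc ‖z‖ * ‖z‖ ^ m = ‖z‖ ^ (m + 1) := by rw [pow_succ, mul_comm]
      _ ≤ _ := h2
      _ ≤ _ := by
        refine Finset.sum_le_sum fun k hk => ?_
        have hB : 0 ≤ B k := (norm_nonneg _).trans (hc k)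
        gcongr
        · exact h1.le
        · exact Nat.lt_succ_iff.1 (Finset.mem_range.1 hk)

theorem norm_le_of_mem_coleSpace (α : A[X]) (hα : α.Monic) (y : X × ℂ)
    (hy : y ∈ ColeSpace α hα) :
    ‖y.2‖ ≤ max 1 (∑ k ∈ Finset.range α.natDegree, ‖(α.coeff k : C(X, ℂ))‖) := by
  have hy' : ∑ k ∈ Finset.range (α.natDegree + 1), (α.coeff k : C(X, ℂ)) y.1 * y.2 ^ k = 0 := hy
  rw [Finset.sum_range_succ, hα.coeff_natDegree] at hy'
  have h1 : ((1 : A) : C(X, ℂ)) y.1 = 1 := rfl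
  rw [h1, one_mul] at hy'
  exact norm_le_of_sum_eq_zero
    (fun k => ContinuousMap.norm_coe_le_norm (α.coeff k : C(X, ℂ)) y.1) hy'

instance coleSpace_compactSpace (α : A[X]) (hα : α.Monic) : CompactSpace (ColeSpace α hα) := by
  have hcl : IsClosed (ColeSpace α hα) := by
    refine isClosed_eq (continuous_finsetSum _ fun k _ => ?_) continuous_const
    exact ((α.coeff k : C(X, ℂ)).continuous.comp continuous_fst).mul (continuous_snd.pow k)
  refine isCompact_iff_compactSpace.1 (IsCompact.of_isClosed_subset
    ((isCompact_univ (X := X)).prod (isCompact_closedBall (0 : ℂ)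
      (max 1 (∑ k ∈ Finset.range α.natDegree, ‖(α.coeff k : C(X, ℂ))‖)))) hcl fun y hy => ?_)
  exact ⟨Set.mem_univ _, mem_closedBall_zero_iff.2 (norm_le_of_mem_coleSpace α hα y hy)⟩

/-- The projection `π : X^α → X`. -/
def coleProj (α : A[X]) (hα : α.Monic) : C(ColeSpace α hα, X) :=
  ⟨fun y => y.1.1, by fun_prop⟩

/-- The coordinate function `p_α : X^α → ℂ`, `(κ, z) ↦ z`. -/
def coleRoot (α : A[X]) (hα : α.Monic) : C(ColeSpace α hα, ℂ) :=
  ⟨fun y => y.1.2, by fun_prop⟩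

/-- The homomorphism `A → C(X^α)`, `f ↦ f ∘ π`. -/
noncomputable def colePullback (α : A[X]) (hα : α.Monic) : A →ₐ[ℂ] C(ColeSpace α hα, ℂ) :=
  (ContinuousMap.compRightAlgHom ℂ ℂ (coleProj α hα)).comp A.val

/-- The simple Cole extension `A^α`: the closed subalgebra of `C(X^α)` generated by the functions
`f ∘ π` with `f ∈ A` together with `p_α`. -/
noncomputable def ColeExtension (α : A[X]) (hα : α.Monic) : Subalgebra ℂ C(ColeSpace α hα, ℂ) :=
  (Algebra.adjoin ℂ (Set.range (colePullback α hα) ∪ {coleRoot α hα})).topologicalClosure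

/-- The embedding `π* : A → A^α`, `f ↦ f ∘ π`. -/
noncomputable def coleEmbedding (α : A[X]) (hα : α.Monic) : A →ₐ[ℂ] ColeExtension α hα :=
  (colePullback α hα).codRestrict (ColeExtension α hα) fun a =>
    Subalgebra.le_topologicalClosure _ (Algebra.subset_adjoin (Or.inl ⟨a, rfl⟩))

end Cole

/-! ### The disc algebra -/

/-- The disc algebra: continuous functions on the closed unit disc that are analytic in the open
unit disc. -/
noncomputable def discAlgebra : Subalgebra ℂ C(Metric.closedBall (0 : ℂ) 1, ℂ) where
  carrier := {f | ∃ F : ℂ → ℂ, DifferentiableOn ℂ F (Metric.ball 0 1) ∧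
    ∀ w : Metric.closedBall (0 : ℂ) 1, (w : ℂ) ∈ Metric.ball (0 : ℂ) 1 → F w = f w}
  mul_mem' := by
    rintro f g ⟨F, hF, hFf⟩ ⟨G, hG, hGg⟩
    exact ⟨F * G, hF.mul hG, fun w hw => by simp [hFf w hw, hGg w hw]⟩
  add_mem' := by
    rintro f g ⟨F, hF, hFf⟩ ⟨G, hG, hGg⟩
    exact ⟨F + G, hF.add hG, fun w hw => by simp [hFf w hw, hGg w hw]⟩
  algebraMap_mem' := by
    intro c
    exact ⟨fun _ => c, differentiableOn_const c, fun w _ => by simp⟩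

/-- The coordinate function `z` of the disc algebra. -/
noncomputable def discAlgebraCoord : discAlgebra :=
  ⟨⟨fun w => (w : ℂ), continuous_subtype_val⟩, fun w => w, differentiableOn_id, fun _ _ => rfl⟩

/-! Sending `x` to `p_α` and `a` to `a ∘ π` defines a homomorphism from `A[x]/(α)` to `C(X^α)` whose
range is the algebra generated by `π*(A)` and `p_α`, hence dense in `A^α`. It is bounded, because
the roots of `α` at the points of `X` lie in a fixed disc. Everything rests on a bound in the other
direction.

Write a class as `∑ c_k x^k` with `k < n`, let `f` be its image, and fix `κ ∈ X`. Let `r₁, …, rₙ` be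
the roots of `α` at `κ`, with multiplicity, and `V` their Vandermonde matrix. Then `V` maps the
vector `c_k(κ)` to the values `f(κ, rᵢ)`. Multiplying by the adjugate gives `det V • c(κ)`, and
`|det V|² = |d(κ)|`, so `‖c_k d‖ ≤ M ‖f‖`, with `M` uniform by compactness of the set of possible
roots (`exists_norm_coeff_mul_discr_le`). No matrix is inverted, so zeros of `d` do no harm. As `d`
is not a topological zero divisor, multiplication by `d` is bounded below
(`exists_pos_forall_norm_le_norm_mul`), and `‖c_k‖ ≤ K ‖f‖`. Hence the homomorphism is injective
with continuous inverse on its range, and completeness of `A` makes the range closed, that is, equal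
to `A^α`.

For the disc algebra, the maximum principle shows that multiplication by `z` does not decrease the
norm, and naturality follows by approximating `f` with the dilations `w ↦ f(sw)`, `s < 1`. -/

/-! ### Discriminants and Vandermonde determinants -/

section Discriminant

/-- Up to a sign, the discriminant is the resultant of `f` and `f'` taken with formal degrees `n`
and `n - 1`. Monicity preserves `n`, so this resultant commutes with `φ` even if the degree of `f'`
drops; the sign is a unit and cancels. -/
theorem Polynomial.Monic.discr_map {R S : Type*} [CommRing R] [CommRing S] [Nontrivial S]
    {f : R[X]} (hf : f.Monic) (hn : 0 < f.natDegree) (φ : R →+* S) :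
    (f.map φ).discr = φ f.discr := by
  have hd : (f.map φ).natDegree = f.natDegree := hf.natDegree_map φ
  have h1 := resultant_deriv (natDegree_pos_iff_degree_pos.1 hn)
  have h2 := resultant_deriv (f := f.map φ) (natDegree_pos_iff_degree_pos.1 (hd.symm ▸ hn))
  rw [hd, derivative_map, resultant_map_map, h1, (hf.map φ).leadingCoeff, hf.leadingCoeff] at h2
  simp only [mul_one, map_mul, map_pow, map_neg, map_one] at h2
  have hu : IsUnit ((-1 : S) ^ (f.natDegree * (f.natDegree - 1) / 2)) :=
    (isUnit_one.neg).pow _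
  exact (hu.mul_left_cancel h2).symm

/-- Up to sign the discriminant is `∏ᵢ f'(rᵢ) = ∏_{i ≠ j} (rᵢ - rⱼ)`, in which every pair of indices
occurs twice. The roots may coincide. -/
theorem Polynomial.norm_discr_prod_X_sub_C {n : ℕ} (hn : 0 < n) (r : Fin n → ℂ) :
    ‖(∏ i, (X - C (r i))).discr‖ = ‖(Matrix.vandermonde r).det‖ ^ 2 := by
  set f : ℂ[X] := ∏ i, (X - C (r i)) with hf
  have hfm : f.Monic := monic_prod_of_monic _ _ fun i _ => monic_X_sub_C (r i)
  have hfd : f.natDegree = n := by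
    rw [hf, natDegree_prod_of_monic _ _ fun i _ => monic_X_sub_C (r i)]
    simp
  have h1 := resultant_deriv (f := f) (natDegree_pos_iff_degree_pos.1 (hfd.symm ▸ hn))
  have h2 : resultant f f.derivative f.natDegree (f.natDegree - 1) =
      ∏ i, eval (r i) f.derivative := by
    have := resultant_prod_left Finset.univ (fun i => X - C (r i)) f.derivative
      (f.natDegree - 1) (by simp) (natDegree_derivative_le f)
    rw [← hf] at this
    rw [this]
    refine Finset.prod_congr rfl fun i _ => ?_
    rw [natDegree_X_sub_C, resultant_X_sub_C_left _ _ _ (natDegree_derivative_le f)]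
  have h3 : ∀ i, eval (r i) f.derivative = ∏ j ∈ Finset.univ.erase i, (r i - r j) := by
    intro i
    rw [hf, derivative_prod_finset, eval_finsetSum, Finset.sum_eq_single i]
    · simp [eval_prod]
    · intro j _ hj
      have : i ∈ Finset.univ.erase j := by simp [hj.symm]
      simp [eval_prod, Finset.prod_eq_zero this]
    · simp
  have h4 : ‖f.discr‖ = ∏ i, ∏ j ∈ Finset.univ.erase i, ‖r i - r j‖ := by
    have := congrArg norm (h1.symm.trans h2)
    rw [hfm.leadingCoeff] at this
    simpa [h3, norm_prod] using this
  have h5 : ∀ i : Fin n, ∏ j ∈ Finset.univ.erase i, ‖r i - r j‖ =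
      (∏ j ∈ Finset.Ioi i, ‖r i - r j‖) * ∏ j ∈ Finset.Iio i, ‖r i - r j‖ := by
    intro i
    rw [← Finset.prod_union]
    · refine Finset.prod_congr ?_ fun _ _ => rfl
      ext j
      simp [lt_or_lt_iff_ne, eq_comm]
    · exact Finset.disjoint_left.2 fun j h h' =>
        lt_asymm (Finset.mem_Ioi.1 h) (Finset.mem_Iio.1 h')
  have h6 : ∏ i : Fin n, ∏ j ∈ Finset.Iio i, ‖r i - r j‖ =
      ∏ i : Fin n, ∏ j ∈ Finset.Ioi i, ‖r j - r i‖ :=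
    Finset.prod_comm' fun i j => by simp
  rw [h4, Finset.prod_congr rfl fun i _ => h5 i, Finset.prod_mul_distrib, h6,
    Matrix.det_vandermonde, norm_prod, sq]
  simp_rw [norm_prod]
  congr 1
  simp_rw [norm_sub_rev]

/-- The coefficients of a polynomial of degree less than `n`, multiplied by the discriminant of
`∏ (x - rᵢ)`, are controlled by the values of the polynomial at `r₁, …, rₙ`. -/
theorem exists_norm_discr_mul_norm_le {n : ℕ} (hn : 0 < n) (R : ℝ) :
    ∃ M : ℝ, 0 ≤ M ∧ ∀ r : Fin n → ℂ, (∀ i, ‖r i‖ ≤ R) → ∀ (c : Fin n → ℂ) (S : ℝ),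
      (∀ i, ‖∑ k : Fin n, c k * r i ^ (k : ℕ)‖ ≤ S) →
        ∀ k, ‖(∏ i, (X - C (r i))).discr‖ * ‖c k‖ ≤ M * S := by
  -- The adjugate costs only one factor `det V`, whereas the discriminant has modulus `|det V|²`;
  -- the remaining factor is absorbed in this continuous function, which is bounded on the ball of
  -- root vectors.
  let F : (Fin n → ℂ) → ℝ := fun r =>
    ∑ k, ∑ i, ‖(Matrix.vandermonde r).det‖ * ‖(Matrix.vandermonde r).adjugate k i‖
  have hV : Continuous fun r : Fin n → ℂ => Matrix.vandermonde r := by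
    refine continuous_matrix fun i j => ?_
    simp only [Matrix.vandermonde_apply]
    fun_prop
  have hF : Continuous F := by
    refine continuous_finsetSum _ fun k _ => continuous_finsetSum _ fun i _ => ?_
    exact hV.matrix_det.norm.mul (hV.matrix_adjugate.matrix_elem k i).norm
  obtain ⟨M, hM⟩ := (isCompact_closedBall (0 : Fin n → ℂ) |R|).exists_bound_of_continuousOn
    hF.continuousOn
  refine ⟨max M 0, le_max_right _ _, fun r hr c S hS k => ?_⟩
  have hS0 : 0 ≤ S := (norm_nonneg _).trans (hS ⟨0, hn⟩)
  have hrM : F r ≤ max M 0 := by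
    refine (le_abs_self _).trans ((hM r ?_).trans (le_max_left _ _))
    rw [mem_closedBall_zero_iff, pi_norm_le_iff_of_nonneg (abs_nonneg _)]
    exact fun i => (hr i).trans (le_abs_self R)
  have hval : ∀ i, ((Matrix.vandermonde r).mulVec c) i = ∑ k : Fin n, c k * r i ^ (k : ℕ) := by
    intro i
    simp [Matrix.mulVec, dotProduct, mul_comm]
  have hdet : (Matrix.vandermonde r).det * c k =
      ∑ i, (Matrix.vandermonde r).adjugate k i * ∑ k : Fin n, c k * r i ^ (k : ℕ) := by
    -- Cramer's rule without division, valid also for repeated roots.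
    have : (Matrix.vandermonde r).adjugate.mulVec ((Matrix.vandermonde r).mulVec c) =
        (Matrix.vandermonde r).det • c := by
      rw [Matrix.mulVec_mulVec, Matrix.adjugate_mul, Matrix.smul_mulVec, Matrix.one_mulVec]
    have := congrFun this k
    simp only [Pi.smul_apply, smul_eq_mul] at this
    rw [← this, Matrix.mulVec, dotProduct]
    simp_rw [hval]
  calc ‖(∏ i, (X - C (r i))).discr‖ * ‖c k‖
      = ‖(Matrix.vandermonde r).det‖ * ‖(Matrix.vandermonde r).det * c k‖ := by
        rw [norm_discr_prod_X_sub_C hn, norm_mul]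
        ring
    _ ≤ ‖(Matrix.vandermonde r).det‖ *
          ∑ i, ‖(Matrix.vandermonde r).adjugate k i‖ * S := by
        rw [hdet]
        gcongr
        refine (norm_sum_le _ _).trans (Finset.sum_le_sum fun i _ => ?_)
        rw [norm_mul]
        gcongr
        exact hS i
    _ = (∑ i, ‖(Matrix.vandermonde r).det‖ * ‖(Matrix.vandermonde r).adjugate k i‖) * S := by
        rw [Finset.mul_sum, Finset.sum_mul]
        exact Finset.sum_congr rfl fun i _ => by ring
    _ ≤ F r * S := by
        gcongr
        exact Finset.single_le_sum (f := fun k => ∑ i, ‖(Matrix.vandermonde r).det‖ *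
          ‖(Matrix.vandermonde r).adjugate k i‖)
          (fun _ _ => Finset.sum_nonneg fun _ _ => by positivity) (Finset.mem_univ k)
    _ ≤ max M 0 * S := by gcongr

end Discriminant

/-- If no `ε` works, elements violating the bound for `ε = 1/(m+1)`, rescaled to norm one, witness
that `d` is a topological zero divisor. -/
theorem exists_pos_forall_norm_le_norm_mul {A : Type*} [NormedCommRing A] [NormedAlgebra ℂ A]
    {d : A}
    (hd : ¬ IsTopologicalZeroDivisor d) : ∃ ε : ℝ, 0 < ε ∧ ∀ u : A, ε * ‖u‖ ≤ ‖u * d‖ := by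
  by_contra! h
  refine hd ?_
  choose u hu using fun m : ℕ => h (1 / ((m : ℝ) + 1)) (by positivity)
  have hu0 : ∀ m, ‖u m‖ ≠ 0 := by
    intro m h0
    have := hu m
    rw [norm_eq_zero.1 h0] at this
    simp at this
  refine ⟨fun m => ((‖u m‖ : ℂ)⁻¹) • u m, fun m => ?_, ?_⟩
  · rw [norm_smul, norm_inv, Complex.norm_real, norm_norm, inv_mul_cancel₀ (hu0 m)]
  · refine squeeze_zero_norm (fun m => ?_) (tendsto_one_div_add_atTop_nhds_zero_nat (𝕜 := ℝ))
    rw [smul_mul_assoc, norm_smul, norm_inv, Complex.norm_real, norm_norm]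
    have hpos : 0 < ‖u m‖ := (norm_nonneg _).lt_of_ne' (hu0 m)
    rw [inv_mul_le_iff₀ hpos, mul_comm ‖u m‖]
    exact (hu m).le

/-! ### The disc algebra -/

section DiscAlgebra

open Metric

/-- Closedness is Weierstrass' theorem on uniform limits of analytic functions; the coordinate
function alone separates points. -/
theorem isUniformAlgebra_discAlgebra : IsUniformAlgebra discAlgebra where
  isClosed := by
    rw [← isSeqClosed_iff_isClosed]
    intro f g hf hfg
    choose F hF hFf using hf
    have hex : ∀ w ∈ ball (0 : ℂ) 1, w ∈ closedBall (0 : ℂ) 1 := fun w hw =>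
      ball_subset_closedBall hw
    classical
    refine ⟨fun w => if hw : w ∈ closedBall (0 : ℂ) 1 then g ⟨w, hw⟩ else 0, ?_, ?_⟩
    · refine TendstoLocallyUniformlyOn.differentiableOn (F := F) (φ := Filter.atTop) ?_
        (Filter.Eventually.of_forall hF) isOpen_ball
      refine TendstoUniformlyOn.tendstoLocallyUniformlyOn ?_
      rw [ContinuousMap.tendsto_iff_tendstoUniformly, Metric.tendstoUniformly_iff] at hfg
      rw [Metric.tendstoUniformlyOn_iff]
      intro ε hε
      filter_upwards [hfg ε hε] with m hm w hw
      rw [dif_pos (hex w hw), hFf m ⟨w, hex w hw⟩ hw]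
      exact hm ⟨w, hex w hw⟩
    · intro w _
      exact dif_pos w.2
  separatesPoints := by
    intro x y hxy
    exact ⟨discAlgebraCoord, ⟨_, discAlgebraCoord.2, rfl⟩, fun h => hxy (Subtype.ext h)⟩

/-- The analytic function in the definition of `discAlgebra` is unrelated to `f` on the circle.
Extending `f` by zero gives one function that is both analytic inside and continuous up to the
boundary, as the maximum principle requires. -/
theorem discAlgebra_exists_diffContOnCl (f : discAlgebra) :
    ∃ F : ℂ → ℂ, DiffContOnCl ℂ F (ball 0 1) ∧
      ∀ w : closedBall (0 : ℂ) 1, F w = (f : C(closedBall (0 : ℂ) 1, ℂ)) w := by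
  obtain ⟨f, G, hG, hGf⟩ := f
  classical
  let F : ℂ → ℂ := fun w => if hw : w ∈ closedBall (0 : ℂ) 1 then f ⟨w, hw⟩ else 0
  have hFf : ∀ w : closedBall (0 : ℂ) 1, F w = f w := fun w => dif_pos w.2
  refine ⟨F, ⟨hG.congr fun w hw => ?_, ?_⟩, hFf⟩
  · rw [hFf ⟨w, ball_subset_closedBall hw⟩, hGf ⟨w, ball_subset_closedBall hw⟩ hw]
  · rw [closure_ball (0 : ℂ) one_ne_zero, continuousOn_iff_continuous_domRestrict]
    exact f.continuous.congr fun w => (hFf w).symm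

/-- On the unit circle `|u| = |u z|`, and the maximum principle carries the bound for `u` to the
whole disc. -/
theorem norm_le_norm_mul_discAlgebraCoord (u : discAlgebra) : ‖u‖ ≤ ‖u * discAlgebraCoord‖ := by
  obtain ⟨F, hF, hFu⟩ := discAlgebra_exists_diffContOnCl u
  change ‖(u : C(closedBall (0 : ℂ) 1, ℂ))‖ ≤ ‖(u * discAlgebraCoord : C(closedBall (0 : ℂ) 1, ℂ))‖
  refine (ContinuousMap.norm_le _ (norm_nonneg _)).2 fun w => ?_
  rw [← hFu]
  refine Complex.norm_le_of_forall_mem_frontier_norm_le isBounded_ball hF (fun z hz => ?_) ?_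
  · rw [frontier_ball (0 : ℂ) one_ne_zero] at hz
    have hz' : z ∈ closedBall (0 : ℂ) 1 := sphere_subset_closedBall hz
    have h := (u * discAlgebraCoord : C(closedBall (0 : ℂ) 1, ℂ)).norm_coe_le_norm ⟨z, hz'⟩
    have h1 : (u * discAlgebraCoord : C(closedBall (0 : ℂ) 1, ℂ)) ⟨z, hz'⟩ = F z * z := by
      rw [ContinuousMap.mul_apply, ← hFu]
      rfl
    rw [h1, norm_mul, mem_sphere_zero_iff_norm.1 hz, mul_one] at h
    exact h
  · rw [closure_ball (0 : ℂ) one_ne_zero]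
    exact w.2

theorem AlgHom.apply_algebraMap_add_sub_mul {K R : Type*} [CommRing K] [CommRing R] [Algebra K R]
    (ω : R →ₐ[K] K) (c : K) (z q : R) :
    ω (algebraMap K R c + (z - algebraMap K R (ω z)) * q) = c := by
  simp

/-- If `F` is differentiable near the closed disc, then `F` restricts to an element of the disc
algebra, at which every character `ω` takes the value `F (ω z)`. -/
theorem exists_discAlgebra_apply_eq {U : Set ℂ} (hU : IsOpen U) (hUD : closedBall 0 1 ⊆ U)
    {F : ℂ → ℂ} (hF : DifferentiableOn ℂ F U) (ω : discAlgebra →ₐ[ℂ] ℂ)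
    (hω : ω discAlgebraCoord ∈ closedBall (0 : ℂ) 1) :
    ∃ g : discAlgebra, (∀ w : closedBall (0 : ℂ) 1, (g : C(closedBall (0 : ℂ) 1, ℂ)) w = F w) ∧
      ω g = F (ω discAlgebraCoord) := by
  have hres : ∀ G : ℂ → ℂ, DifferentiableOn ℂ G U → ∃ g : discAlgebra,
      ∀ w : closedBall (0 : ℂ) 1, (g : C(closedBall (0 : ℂ) 1, ℂ)) w = G w := fun G hG =>
    ⟨⟨⟨fun w => G w, continuousOn_iff_continuous_domRestrict.1 (hG.continuousOn.mono hUD)⟩,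
      G, hG.mono (ball_subset_closedBall.trans hUD), fun _ _ => rfl⟩, fun _ => rfl⟩
  obtain ⟨g, hg⟩ := hres F hF
  -- The difference quotient has a removable singularity at `ω z`, so it lies in the algebra and `g
  -- - F(ω z)` is a multiple of `z - ω z`, which `ω` kills.
  obtain ⟨q, hq⟩ := hres (dslope F (ω discAlgebraCoord))
    ((Complex.differentiableOn_dslope (hU.mem_nhds (hUD hω))).2 hF)
  refine ⟨g, hg, ?_⟩
  set l := ω discAlgebraCoord with hl
  have hgq : g = algebraMap ℂ discAlgebra (F l) +
      (discAlgebraCoord - algebraMap ℂ discAlgebra l) * q := by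
    refine Subtype.ext (ContinuousMap.ext fun w => ?_)
    have h := sub_smul_dslope F l w
    change (g : C(closedBall (0 : ℂ) 1, ℂ)) w =
      F l + ((w : ℂ) - l) * (q : C(closedBall (0 : ℂ) 1, ℂ)) w
    rw [hg, hq]
    rw [smul_eq_mul] at h
    rw [h]
    ring
  rw [hgq, hl]
  exact AlgHom.apply_algebraMap_add_sub_mul ω _ _ _

/-- The point is `l = φ(z)`. Each dilation `w ↦ f(sw)`, `s < 1`, is analytic near the closed disc,
so `φ` evaluates it at `l`; since `φ` is contractive and the dilations converge uniformly to `f` as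
`s → 1`, so does `φ` for `f`. -/
theorem isNatural_discAlgebra : IsNatural discAlgebra := by
  intro ω
  have : CompleteSpace discAlgebra :=
    isUniformAlgebra_discAlgebra.isClosed.completeSpace_coe
  set φ : discAlgebra →ₐ[ℂ] ℂ := WeakDual.CharacterSpace.equivAlgHom ω with hφ
  have hφω : ∀ f, ω f = φ f := fun f => rfl
  have h1 : ‖(1 : discAlgebra)‖ ≤ 1 :=
    (ContinuousMap.norm_le _ zero_le_one).2 fun w => by simp
  have hφ1 : ∀ f : discAlgebra, ‖φ f‖ ≤ ‖f‖ := fun f =>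
    (AlgHom.norm_apply_le_self_mul_norm_one φ f).trans
      (mul_le_of_le_one_right (norm_nonneg _) h1)
  have hz : ‖discAlgebraCoord‖ ≤ 1 :=
    (ContinuousMap.norm_le _ zero_le_one).2 fun w => mem_closedBall_zero_iff.1 w.2
  set l : ℂ := φ discAlgebraCoord with hl
  have hl1 : l ∈ closedBall (0 : ℂ) 1 := mem_closedBall_zero_iff.2 ((hφ1 _).trans hz)
  refine ⟨⟨l, hl1⟩, fun f => ?_⟩
  rw [hφω]
  obtain ⟨F, hF, hFf⟩ := discAlgebra_exists_diffContOnCl f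
  -- Treating dilation as a continuous path of self-maps ending at the identity makes the uniform
  -- convergence `f ∘ D s → f` a case of continuity of composition in the compact-open topology.
  let D (s : Set.Icc (0 : ℝ) 1) : C(closedBall (0 : ℂ) 1, closedBall (0 : ℂ) 1) :=
    ⟨fun w => ⟨(s : ℝ) * w, by
      have h1 := mem_closedBall_zero_iff.1 w.2
      rw [mem_closedBall_zero_iff, norm_mul, Complex.norm_real, Real.norm_of_nonneg s.2.1]
      exact mul_le_one₀ s.2.2 (norm_nonneg _) h1⟩, by fun_prop⟩
  have hD : Continuous D :=
    ContinuousMap.continuous_of_continuous_uncurry _ (by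
      simp only [D, Function.uncurry_def, ContinuousMap.coe_mk]
      fun_prop)
  have hD1 : D 1 = ContinuousMap.id _ := by
    ext w
    simp [D]
  set f' : C(closedBall (0 : ℂ) 1, ℂ) := f.1 with hf'
  have hle (s : Set.Icc (0 : ℝ) 1) (hs : (s : ℝ) < 1) :
      ‖φ f - f' (D s ⟨l, hl1⟩)‖ ≤ ‖f' - f'.comp (D s)‖ := by
    have hc : Continuous fun w : ℂ => ((s : ℝ) : ℂ) * w := by fun_prop
    obtain ⟨g, hg, hφg⟩ := exists_discAlgebra_apply_eq (isOpen_ball.preimage hc)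
      (F := fun w => F ((s : ℝ) * w)) (fun w hw => by
        rw [Set.mem_preimage, mem_ball_zero_iff, norm_mul, Complex.norm_real,
          Real.norm_of_nonneg s.2.1]
        exact (mul_le_of_le_one_right s.2.1 (mem_closedBall_zero_iff.1 hw)).trans_lt hs)
      (hF.differentiableOn.comp (by fun_prop) fun w hw => hw) φ hl1
    have hgf : (g : C(closedBall (0 : ℂ) 1, ℂ)) = f'.comp (D s) := by
      ext w
      rw [hg, ContinuousMap.comp_apply, hf', ← hFf]
      rfl
    have hv : f' (D s ⟨l, hl1⟩) = φ g := by
      rw [hφg, hf', ← hFf]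
      rfl
    rw [hv, ← map_sub, ← hgf]
    exact hφ1 (f - g)
  let s : ℕ → Set.Icc (0 : ℝ) 1 := fun m =>
    ⟨(m : ℝ) / (m + 1), by positivity, div_le_one_of_le₀ (by linarith) (by positivity)⟩
  have hs1 : ∀ m, (s m : ℝ) < 1 := fun m =>
    (div_lt_one (by positivity)).2 (by linarith)
  have hs : Filter.Tendsto s Filter.atTop (𝓝 1) :=
    tendsto_subtype_rng.2 (tendsto_natCast_div_add_atTop (1 : ℝ))
  have hlim1 : Filter.Tendsto (fun m => ‖φ f - f' (D (s m) ⟨l, hl1⟩)‖) Filter.atTop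
      (𝓝 ‖φ f - f' (D 1 ⟨l, hl1⟩)‖) := by
    have hcont : Continuous fun s => ‖φ f - f' (D s ⟨l, hl1⟩)‖ := by fun_prop
    exact (hcont.tendsto 1).comp hs
  have hlim2 : Filter.Tendsto (fun m => ‖f' - f'.comp (D (s m))‖) Filter.atTop
      (𝓝 ‖f' - f'.comp (D 1)‖) := by
    have hcont : Continuous fun s => ‖f' - f'.comp (D s)‖ :=
      (continuous_const.sub ((ContinuousMap.continuous_postcomp f').comp hD)).norm
    exact (hcont.tendsto 1).comp hs
  have h := le_of_tendsto_of_tendsto' hlim1 hlim2 fun m => hle (s m) (hs1 m)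
  rw [hD1, ContinuousMap.comp_id, sub_self, norm_zero, ContinuousMap.id_apply] at h
  exact sub_eq_zero.1 (norm_le_zero_iff.1 h)

theorem discr_X_sq_sub_C {R : Type*} [CommRing R] [Nontrivial R] (a : R) :
    (X ^ 2 - C a).discr = 4 * a := by
  rw [discr_of_degree_eq_two (degree_X_pow_sub_C two_pos a)]
  simp [coeff_C]

theorem not_isTopologicalZeroDivisor_four_mul_discAlgebraCoord :
    ¬ IsTopologicalZeroDivisor (4 * discAlgebraCoord) := by
  rintro ⟨u, hu, hlim⟩
  have h4 : ∀ m, (1 : ℝ) ≤ ‖u m * (4 * discAlgebraCoord)‖ := by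
    intro m
    have h : u m * (4 * discAlgebraCoord) = (4 : ℂ) • (u m * discAlgebraCoord) := by
      rw [Algebra.smul_def, map_ofNat, mul_left_comm]
    have h1 := norm_le_norm_mul_discAlgebraCoord (u m)
    have h2 : ‖(4 : ℂ) • (u m * discAlgebraCoord)‖ = ‖(4 : ℂ)‖ * ‖u m * discAlgebraCoord‖ :=
      norm_smul _ _
    have h3 : ‖(4 : ℂ)‖ = 4 := by norm_num
    rw [hu m] at h1
    rw [h, h2, h3]
    linarith
  have := ge_of_tendsto' (tendsto_norm_zero.comp hlim) h4
  exact absurd this (by norm_num)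

end DiscAlgebra

/-- Listing the roots by `Fin n`, with multiplicity, is what makes them the nodes of a square
Vandermonde matrix. -/
theorem Polynomial.Monic.exists_eq_prod_X_sub_C_of_isAlgClosed {K : Type*} [Field K]
    [IsAlgClosed K] {p : K[X]} (hp : p.Monic) {n : ℕ} (hn : p.natDegree = n) :
    ∃ r : Fin n → K, p = ∏ i, (X - C (r i)) := by
  have hsp := IsAlgClosed.splits p
  have hcard : p.roots.toList.length = n := by
    rw [Multiset.length_toList, ← hn, hsp.natDegree_eq_card_roots]
  subst hcard
  refine ⟨p.roots.toList.get, ?_⟩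
  have h := hsp.eq_prod_roots_of_monic hp
  rw [← Multiset.coe_toList p.roots, Multiset.map_coe, Multiset.prod_coe] at h
  conv_lhs => rw [h]
  rw [← List.prod_ofFn]
  congr 1
  exact (List.map_ofFn (f := p.roots.toList.get) (g := fun x => X - C x) ▸
    congrArg _ (List.ofFn_get p.roots.toList).symm)

/-! ### The comparison map from `A[x]/(α)` to `C(X^α)` -/

section ArensHoffmanCole

variable {X : Type*} [TopologicalSpace X] {A : Subalgebra ℂ C(X, ℂ)}

/-- Evaluation of a polynomial over `A` at a point of `X × ℂ`. -/
theorem eval₂_colePullback_coleRoot_apply (α : A[X]) (hα : α.Monic) (δ : A[X])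
    (y : ColeSpace α hα) :
    eval₂ (colePullback α hα : A →+* C(ColeSpace α hα, ℂ)) (coleRoot α hα) δ y =
      eval y.1.2 (δ.map (pointEval A y.1.1 : A →+* ℂ)) := by
  rw [eval_map]
  exact hom_eval₂ δ (colePullback α hα : A →+* C(ColeSpace α hα, ℂ))
    (ContinuousMap.evalAlgHom ℂ ℂ y : C(ColeSpace α hα, ℂ) →+* ℂ) (coleRoot α hα)

theorem mem_coleSpace_iff (α : A[X]) (hα : α.Monic) (y : X × ℂ) :
    y ∈ ColeSpace α hα ↔ eval y.2 (α.map (pointEval A y.1 : A →+* ℂ)) = 0 := by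
  rw [eval_map, eval₂_eq_sum_range]
  rfl

theorem coleProj_surjective (α : A[X]) (hα : α.Monic) (hn : 0 < α.natDegree) :
    Function.Surjective (coleProj α hα) := by
  intro x
  have hd : (α.map (pointEval A x : A →+* ℂ)).degree ≠ 0 := by
    refine (natDegree_pos_iff_degree_pos.1 ?_).ne'
    rwa [hα.natDegree_map]
  obtain ⟨z, hz⟩ := IsAlgClosed.exists_root _ hd
  exact ⟨⟨(x, z), (mem_coleSpace_iff α hα _).2 hz⟩, rfl⟩

theorem colePullback_injective (α : A[X]) (hα : α.Monic) (hn : 0 < α.natDegree) :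
    Function.Injective (colePullback α hα) := by
  intro f g hfg
  refine Subtype.ext (ContinuousMap.ext fun x => ?_)
  obtain ⟨y, rfl⟩ := coleProj_surjective α hα hn x
  exact DFunLike.congr_fun hfg y

/-- The map `(c₀, …, cₙ₋₁) ↦ ∑ (c_k ∘ π) p_α ^ k` into `C(X^α)`. -/
noncomputable def coeffsToCole (α : A[X]) (hα : α.Monic) :
    (Fin α.natDegree → A) →ₗ[ℂ] C(ColeSpace α hα, ℂ) :=
  ∑ k : Fin α.natDegree, (LinearMap.mulRight ℂ (coleRoot α hα ^ (k : ℕ))).comp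
    ((colePullback α hα).toLinearMap.comp (LinearMap.proj k))

theorem coeffsToCole_apply (α : A[X]) (hα : α.Monic) (c : Fin α.natDegree → A) :
    coeffsToCole α hα c = ∑ k, colePullback α hα (c k) * coleRoot α hα ^ (k : ℕ) := by
  simp [coeffsToCole]

variable [CompactSpace X]

/-- The homomorphism `A[x]/(α) → C(X^α)` that extends `f ↦ f ∘ π` and maps `x` to `p_α`. -/
noncomputable def arensHoffmanToCole (α : A[X]) (hα : α.Monic) :
    AdjoinRoot α →ₐ[ℂ] C(ColeSpace α hα, ℂ) :=
  AdjoinRoot.liftAlgHom α (colePullback α hα) (coleRoot α hα) <| by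
    ext y
    exact (eval₂_colePullback_coleRoot_apply α hα α y).trans ((mem_coleSpace_iff α hα y).1 y.2)

theorem arensHoffmanToCole_mk_apply (α : A[X]) (hα : α.Monic) (δ : A[X]) (y : ColeSpace α hα) :
    arensHoffmanToCole α hα (AdjoinRoot.mk α δ) y =
      eval y.1.2 (δ.map (pointEval A y.1.1 : A →+* ℂ)) :=
  eval₂_colePullback_coleRoot_apply α hα δ y

theorem arensHoffmanToCole_of (α : A[X]) (hα : α.Monic) (a : A) :
    arensHoffmanToCole α hα (AdjoinRoot.of α a) = colePullback α hα a :=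
  AdjoinRoot.liftAlgHom_of ..

theorem arensHoffmanToCole_mk_apply_eq_sum (α : A[X]) (hα : α.Monic) {δ : A[X]} {n : ℕ}
    (hδ : δ.natDegree < n) (y : ColeSpace α hα) :
    arensHoffmanToCole α hα (AdjoinRoot.mk α δ) y =
      ∑ k ∈ Finset.range n, (δ.coeff k : C(X, ℂ)) y.1.1 * y.1.2 ^ k := by
  rw [arensHoffmanToCole_mk_apply, eval_map, eval₂_eq_sum_range' _ hδ]
  rfl

/-- Polynomials in `p_α` over `π*(A)` already form an algebra; hence the Cole extension is the
closure of this range. -/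
theorem range_arensHoffmanToCole (α : A[X]) (hα : α.Monic) :
    (arensHoffmanToCole α hα).range =
      Algebra.adjoin ℂ (Set.range (colePullback α hα) ∪ {coleRoot α hα}) := by
  apply le_antisymm
  · rintro _ ⟨b, rfl⟩
    obtain ⟨δ, rfl⟩ := AdjoinRoot.mk_surjective b
    change eval₂ _ _ δ ∈ _
    rw [eval₂_eq_sum_range]
    refine Subalgebra.sum_mem _ fun k _ => Subalgebra.mul_mem _ ?_ (Subalgebra.pow_mem _ ?_ _)
    · exact Algebra.subset_adjoin (Or.inl ⟨_, rfl⟩)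
    · exact Algebra.subset_adjoin (Or.inr rfl)
  · refine Algebra.adjoin_le ?_
    rintro _ (⟨a, rfl⟩ | rfl)
    · exact ⟨AdjoinRoot.of α a, arensHoffmanToCole_of α hα a⟩
    · exact ⟨AdjoinRoot.root α, AdjoinRoot.liftAlgHom_root ..⟩

/-- The coefficients of a polynomial of degree less than that of `α`, multiplied by the
discriminant of `α`, are bounded by the norm of the function induced on `X^α`. -/
theorem exists_norm_coeff_mul_discr_le (α : A[X]) (hα : α.Monic) (hn : 0 < α.natDegree) :
    ∃ M : ℝ, 0 ≤ M ∧ ∀ δ : A[X], δ.natDegree < α.natDegree → ∀ k,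
      ‖δ.coeff k * α.discr‖ ≤ M * ‖arensHoffmanToCole α hα (AdjoinRoot.mk α δ)‖ := by
  obtain ⟨M, hM0, hM⟩ := exists_norm_discr_mul_norm_le hn
    (max 1 (∑ k ∈ Finset.range α.natDegree, ‖(α.coeff k : C(X, ℂ))‖))
  refine ⟨M, hM0, fun δ hδ k => ?_⟩
  rcases lt_or_ge k α.natDegree with hk | hk
  swap
  · rw [coeff_eq_zero_of_natDegree_lt (hδ.trans_le hk), zero_mul, norm_zero]
    positivity
  refine (ContinuousMap.norm_le _ (by positivity)).2 fun x => ?_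
  set e : A →+* ℂ := (pointEval A x : A →+* ℂ) with he
  have hed : (α.map e).natDegree = α.natDegree := hα.natDegree_map e
  -- All these roots lie in the fibre over `x`, so the values of the induced function there are
  -- bounded by its norm.
  obtain ⟨r, hr⟩ := (hα.map e).exists_eq_prod_X_sub_C_of_isAlgClosed hed
  have hmem : ∀ i, (x, r i) ∈ ColeSpace α hα := by
    intro i
    rw [mem_coleSpace_iff]
    change eval (r i) (α.map e) = 0
    rw [hr, eval_prod]
    exact Finset.prod_eq_zero (Finset.mem_univ i) (by simp)
  have h := hM r (fun i => norm_le_of_mem_coleSpace α hα _ (hmem i))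
    (fun k => (δ.coeff k : C(X, ℂ)) x) ‖arensHoffmanToCole α hα (AdjoinRoot.mk α δ)‖
    (fun i => ?_) ⟨k, hk⟩
  · rw [← hr, hα.discr_map hn e, mul_comm, ← norm_mul] at h
    exact h
  · have h1 := arensHoffmanToCole_mk_apply_eq_sum α hα hδ ⟨(x, r i), hmem i⟩
    rw [Finset.sum_range] at h1
    rw [← h1]
    exact ContinuousMap.norm_coe_le_norm _ _

/-! ### The embeddings and the two norm estimates -/

theorem coleEmbedding_injective (α : A[X]) (hα : α.Monic) (hn : 0 < α.natDegree) :
    Function.Injective (coleEmbedding α hα) := fun _ _ h =>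
  colePullback_injective α hα hn (congrArg Subtype.val h)

theorem norm_colePullback_le (α : A[X]) (hα : α.Monic) (a : A) : ‖colePullback α hα a‖ ≤ ‖a‖ :=
  (ContinuousMap.norm_le _ (norm_nonneg _)).2 fun y =>
    ContinuousMap.norm_coe_le_norm (a : C(X, ℂ)) y.1.1

theorem coleEmbedding_continuous (α : A[X]) (hα : α.Monic) : Continuous (coleEmbedding α hα) :=
  AddMonoidHomClass.continuous_of_bound (coleEmbedding α hα) 1 fun a => by
    rw [one_mul]
    exact norm_colePullback_le α hα a

theorem norm_arensHoffmanEmbedding_le {α : A[X]} {t : ℝ} (ht : IsArensHoffmanParameter α t)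
    (a : A) : ‖arensHoffmanEmbedding α t ht a‖ ≤ ‖a‖ := by
  have h := arensHoffmanNorm_mk_le ht (C a)
  rw [← monomial_zero_left, arensHoffmanPolyNorm_monomial, pow_zero, mul_one] at h
  exact h

/-- Following the embedding by the comparison map gives `π*`, which is injective because `π` is
onto. -/
theorem arensHoffmanEmbedding_injective {α : A[X]} {t : ℝ} (ht : IsArensHoffmanParameter α t)
    (hn : 0 < α.natDegree) : Function.Injective (arensHoffmanEmbedding α t ht) := by
  intro a b hab
  refine colePullback_injective α ht.monic hn ?_
  rw [← arensHoffmanToCole_of, ← arensHoffmanToCole_of]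
  exact congrArg (arensHoffmanToCole α ht.monic) hab

/-- The remainder modulo `α` attains the quotient norm, which thus becomes a weighted sum of `n`
coefficient norms. -/
theorem exists_natDegree_lt_mk_eq {α : A[X]} {t : ℝ} (ht : IsArensHoffmanParameter α t)
    (hn : 0 < α.natDegree) (b : ArensHoffmanExtension α t ht) :
    ∃ δ : A[X], δ.natDegree < α.natDegree ∧ AdjoinRoot.mk α δ = b ∧
      ‖b‖ = ∑ k ∈ Finset.range α.natDegree, ‖δ.coeff k‖ * t ^ k := by
  obtain ⟨γ, rfl⟩ := AdjoinRoot.mk_surjective (g := α) b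
  have hδ : (γ %ₘ α).natDegree < α.natDegree :=
    natDegree_modByMonic_lt γ ht.monic fun h => by simp [h] at hn
  refine ⟨γ %ₘ α, hδ, ?_, ?_⟩
  · refine AdjoinRoot.mk_eq_mk.2 ⟨-(γ /ₘ α), ?_⟩
    linear_combination modByMonic_add_div γ α
  · rw [← arensHoffmanPolyNorm_eq t _ hδ]
    exact arensHoffmanNorm_mk ht γ

/-- The homomorphism `A[x]/(α) → C(X^α)` is bounded. -/
theorem exists_norm_arensHoffmanToCole_le {α : A[X]} {t : ℝ} (ht : IsArensHoffmanParameter α t)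
    (hn : 0 < α.natDegree) :
    ∃ K : ℝ, ∀ b : ArensHoffmanExtension α t ht, ‖arensHoffmanToCole α ht.monic b‖ ≤ K * ‖b‖ := by
  set R := max 1 (∑ k ∈ Finset.range α.natDegree, ‖(α.coeff k : C(X, ℂ))‖)
  have hR : 0 ≤ R := zero_le_one.trans (le_max_left _ _)
  have htp := ht.pos
  have hRt : 0 ≤ R / t := div_nonneg hR htp.le
  -- With `|p_α| ≤ R`, the `k`-th term is at most `‖c_k‖ R^k = (R/t)^k (‖c_k‖ t^k)`, and the last
  -- factor is at most `‖b‖`.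
  refine ⟨∑ k ∈ Finset.range α.natDegree, (R / t) ^ k, fun b => ?_⟩
  obtain ⟨δ, hδ, hδb, hb⟩ := exists_natDegree_lt_mk_eq ht hn b
  refine (ContinuousMap.norm_le _ (mul_nonneg (Finset.sum_nonneg fun k _ => pow_nonneg hRt k)
    (norm_nonneg _))).2 fun y => ?_
  have h0 := arensHoffmanToCole_mk_apply_eq_sum α ht.monic hδ y
  rw [hδb] at h0
  rw [h0, Finset.sum_mul]
  refine (norm_sum_le _ _).trans (Finset.sum_le_sum fun k hk => ?_)
  have h1 : ‖δ.coeff k‖ * t ^ k ≤ ‖b‖ := by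
    rw [hb]
    exact Finset.single_le_sum (f := fun k => ‖δ.coeff k‖ * t ^ k)
      (fun _ _ => mul_nonneg (norm_nonneg _) (pow_nonneg htp.le _)) hk
  have h2 : ‖(δ.coeff k : C(X, ℂ)) y.1.1‖ ≤ ‖δ.coeff k‖ :=
    ContinuousMap.norm_coe_le_norm (δ.coeff k : C(X, ℂ)) _
  have h3 : ‖y.1.2‖ ≤ R := norm_le_of_mem_coleSpace α ht.monic _ y.2
  calc ‖(δ.coeff k : C(X, ℂ)) y.1.1 * y.1.2 ^ k‖
      = ‖(δ.coeff k : C(X, ℂ)) y.1.1‖ * ‖y.1.2‖ ^ k := by rw [norm_mul, norm_pow]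
    _ ≤ ‖δ.coeff k‖ * R ^ k :=
        mul_le_mul h2 (pow_le_pow_left₀ (norm_nonneg _) h3 k) (by positivity) (norm_nonneg _)
    _ = (R / t) ^ k * (‖δ.coeff k‖ * t ^ k) := by
        rw [mul_left_comm, ← mul_pow, div_mul_cancel₀ R htp.ne']
    _ ≤ (R / t) ^ k * ‖b‖ := mul_le_mul_of_nonneg_left h1 (pow_nonneg hRt k)

/-- If the discriminant of `α` is not a topological zero divisor, the coefficients of a polynomial
of degree less than that of `α` are bounded by the norm of the function induced on `X^α`. -/
theorem exists_norm_coeff_le (α : A[X]) (hα : α.Monic) (hn : 0 < α.natDegree)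
    (hd : ¬ IsTopologicalZeroDivisor α.discr) :
    ∃ K : ℝ, 0 ≤ K ∧ ∀ δ : A[X], δ.natDegree < α.natDegree → ∀ k,
      ‖δ.coeff k‖ ≤ K * ‖arensHoffmanToCole α hα (AdjoinRoot.mk α δ)‖ := by
  obtain ⟨ε, hε, hεd⟩ := exists_pos_forall_norm_le_norm_mul hd
  obtain ⟨M, hM0, hM⟩ := exists_norm_coeff_mul_discr_le α hα hn
  refine ⟨M / ε, by positivity, fun δ hδ k => ?_⟩
  rw [div_mul_eq_mul_div, le_div_iff₀' hε]
  exact (hεd _).trans (hM δ hδ k)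

theorem exists_norm_le_norm_arensHoffmanToCole {α : A[X]} {t : ℝ}
    (ht : IsArensHoffmanParameter α t) (hn : 0 < α.natDegree)
    (hd : ¬ IsTopologicalZeroDivisor α.discr) :
    ∃ K : ℝ, ∀ b : ArensHoffmanExtension α t ht, ‖b‖ ≤ K * ‖arensHoffmanToCole α ht.monic b‖ := by
  obtain ⟨K, hK0, hK⟩ := exists_norm_coeff_le α ht.monic hn hd
  have htp := ht.pos
  refine ⟨∑ k ∈ Finset.range α.natDegree, K * t ^ k, fun b => ?_⟩
  obtain ⟨δ, hδ, rfl, hb⟩ := exists_natDegree_lt_mk_eq ht hn b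
  rw [hb, Finset.sum_mul]
  refine Finset.sum_le_sum fun k _ => ?_
  rw [mul_right_comm]
  gcongr
  exact hK δ hδ k

/-! ### Closed range and identification of the Cole extension -/

theorem coeffsToCole_coeff (α : A[X]) (hα : α.Monic) {δ : A[X]} (hδ : δ.natDegree < α.natDegree) :
    coeffsToCole α hα (fun k => δ.coeff k) = arensHoffmanToCole α hα (AdjoinRoot.mk α δ) := by
  ext y
  rw [arensHoffmanToCole_mk_apply_eq_sum α hα hδ, coeffsToCole_apply, Finset.sum_range,
    ContinuousMap.sum_apply]
  rfl

theorem exists_coeff_eq {R : Type*} [CommRing R] {n : ℕ} (hn : 0 < n) (c : Fin n → R) :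
    ∃ δ : R[X], δ.natDegree < n ∧ ∀ k : Fin n, δ.coeff k = c k := by
  refine ⟨∑ k : Fin n, monomial (k : ℕ) (c k), ?_, fun k => ?_⟩
  · refine (Nat.lt_iff_le_pred hn).2 (natDegree_sum_le_of_forall_le _ _ fun k _ => ?_)
    exact (natDegree_monomial_le _).trans (Nat.le_pred_of_lt k.2)
  · rw [finsetSum_coeff, Finset.sum_eq_single k]
    · simp
    · intro j _ hj
      exact coeff_monomial_of_ne _ fun h => hj (Fin.ext h.symm)
    · simp

theorem range_coeffsToCole (α : A[X]) (hα : α.Monic) (hn : 0 < α.natDegree) :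
    Set.range (coeffsToCole α hα) = (arensHoffmanToCole α hα).range := by
  ext f
  constructor
  · rintro ⟨c, rfl⟩
    obtain ⟨δ, hδ, hc⟩ := exists_coeff_eq hn c
    obtain rfl : (fun k : Fin α.natDegree => δ.coeff k) = c := funext hc
    exact ⟨AdjoinRoot.mk α δ, (coeffsToCole_coeff α hα hδ).symm⟩
  · rintro ⟨b, rfl⟩
    obtain ⟨γ, rfl⟩ := AdjoinRoot.mk_surjective b
    have hδ : (γ %ₘ α).natDegree < α.natDegree :=
      natDegree_modByMonic_lt γ hα fun h => by simp [h] at hn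
    refine ⟨fun k => (γ %ₘ α).coeff k, (coeffsToCole_coeff α hα hδ).trans (congrArg _ ?_)⟩
    refine AdjoinRoot.mk_eq_mk.2 ⟨-(γ /ₘ α), ?_⟩
    linear_combination modByMonic_add_div γ α

/-- By division with remainder the range is also the image of `Aⁿ`, which is complete because `A`
is. The coefficient bound makes the map from `Aⁿ` antilipschitz, so its image is closed;
completeness of the Arens–Hoffman norm is not needed. -/
theorem isClosed_range_arensHoffmanToCole (hA : IsUniformAlgebra A) (α : A[X]) (hα : α.Monic)
    (hn : 0 < α.natDegree) (hd : ¬ IsTopologicalZeroDivisor α.discr) :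
    IsClosed ((arensHoffmanToCole α hα).range : Set C(ColeSpace α hα, ℂ)) := by
  have : CompleteSpace A := hA.isClosed.completeSpace_coe
  obtain ⟨K, hK0, hK⟩ := exists_norm_coeff_le α hα hn hd
  have hcont : Continuous (colePullback α hα) :=
    AddMonoidHomClass.continuous_of_bound (colePullback α hα) 1 fun a => by
      rw [one_mul]
      exact norm_colePullback_le α hα a
  let L : (Fin α.natDegree → A) →L[ℂ] C(ColeSpace α hα, ℂ) :=
    ⟨coeffsToCole α hα, by
      change Continuous fun c => coeffsToCole α hα c
      simp_rw [coeffsToCole_apply]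
      exact continuous_finsetSum _ fun k _ =>
        (hcont.comp (continuous_apply k)).mul continuous_const⟩
  have hL : AntilipschitzWith K.toNNReal L := by
    refine L.antilipschitz_of_bound fun c => ?_
    rw [Real.coe_toNNReal K hK0]
    obtain ⟨δ, hδ, hc⟩ := exists_coeff_eq hn c
    obtain rfl : (fun k : Fin α.natDegree => δ.coeff k) = c := funext hc
    rw [pi_norm_le_iff_of_nonneg (by positivity)]
    intro k
    change _ ≤ K * ‖coeffsToCole α hα _‖
    rw [coeffsToCole_coeff α hα hδ]
    exact hK δ hδ k
  rw [← range_coeffsToCole α hα hn]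
  exact hL.isClosed_range L.uniformContinuous

theorem coleExtension_eq_range (hA : IsUniformAlgebra A) (α : A[X]) (hα : α.Monic)
    (hn : 0 < α.natDegree) (hd : ¬ IsTopologicalZeroDivisor α.discr) :
    ColeExtension α hα = (arensHoffmanToCole α hα).range := by
  rw [ColeExtension, ← range_arensHoffmanToCole]
  exact SetLike.coe_injective (isClosed_range_arensHoffmanToCole hA α hα hn hd).closure_eq

theorem isTopologicallyIsomorphicExtension_arensHoffman_cole (hA : IsUniformAlgebra A) {α : A[X]}
    (hα : α.Monic) (hn : 0 < α.natDegree) (hd : ¬ IsTopologicalZeroDivisor α.discr) {t : ℝ}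
    (ht : IsArensHoffmanParameter α t) :
    IsTopologicallyIsomorphicExtension (AlgEquiv.refl : A ≃ₐ[ℂ] A)
      (arensHoffmanEmbedding α t ht) (coleEmbedding α hα) := by
  refine ⟨continuous_id, continuous_id, arensHoffmanEmbedding_injective ht hn,
    AddMonoidHomClass.continuous_of_bound (arensHoffmanEmbedding α t ht) 1 fun a => by
      rw [one_mul]
      exact norm_arensHoffmanEmbedding_le ht a,
    coleEmbedding_injective α hα hn, coleEmbedding_continuous α hα, ?_⟩
  have hrange := coleExtension_eq_range hA α hα hn hd
  obtain ⟨K, hK⟩ := exists_norm_arensHoffmanToCole_le ht hn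
  obtain ⟨K', hK'⟩ := exists_norm_le_norm_arensHoffmanToCole ht hn hd
  let ψ : ArensHoffmanExtension α t ht →ₐ[ℂ] C(ColeSpace α hα, ℂ) := arensHoffmanToCole α hα
  -- The lower norm bound gives injectivity here, and continuity of the inverse below.
  have hψ : Function.Injective ψ := by
    refine (injective_iff_map_eq_zero ψ).2 fun b hb => norm_le_zero_iff.1 ((hK' b).trans ?_)
    change K' * ‖ψ b‖ ≤ 0
    rw [hb, norm_zero, mul_zero]
  let φ : ArensHoffmanExtension α t ht ≃ₐ[ℂ] ColeExtension α hα :=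
    (AlgEquiv.ofInjective ψ hψ).trans (Subalgebra.equivOfEq _ _ hrange.symm)
  have hφ : ∀ b, ‖φ b‖ = ‖arensHoffmanToCole α hα b‖ := fun b => rfl
  refine ⟨φ, AddMonoidHomClass.continuous_of_bound φ K fun b => (hφ b).trans_le (hK b),
    AddMonoidHomClass.continuous_of_bound φ.symm K' fun f => ?_, fun a => ?_⟩
  · have h := hK' (φ.symm f)
    rw [← hφ, φ.apply_symm_apply] at h
    exact h
  · exact Subtype.ext (arensHoffmanToCole_of α hα a)

end ArensHoffmanCole

/-! ### The theorem and the disc algebra example -/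

theorem theorem4p12 :
    (∀ (X : Type*) [TopologicalSpace X] [CompactSpace X] [T2Space X] [Nonempty X]
        (A : Subalgebra ℂ C(X, ℂ)), IsUniformAlgebra A → IsNatural A →
      ∀ (α : A[X]) (hα : α.Monic), 0 < α.natDegree →
      ¬ IsTopologicalZeroDivisor α.discr →
      ∀ (t : ℝ) (ht : IsArensHoffmanParameter α t),
        IsTopologicallyIsomorphicExtension (AlgEquiv.refl : A ≃ₐ[ℂ] A)
          (arensHoffmanEmbedding α t ht) (coleEmbedding α hα)) ∧
    (IsUniformAlgebra discAlgebra ∧ IsNatural discAlgebra ∧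
      (X ^ 2 - C discAlgebraCoord).discr = 4 * discAlgebraCoord ∧
      ¬ IsTopologicalZeroDivisor (X ^ 2 - C discAlgebraCoord).discr ∧
      ∀ (t : ℝ) (ht : IsArensHoffmanParameter (X ^ 2 - C discAlgebraCoord) t),
        IsTopologicallyIsomorphicExtension (AlgEquiv.refl : discAlgebra ≃ₐ[ℂ] discAlgebra)
          (arensHoffmanEmbedding (X ^ 2 - C discAlgebraCoord) t ht)
          (coleEmbedding (X ^ 2 - C discAlgebraCoord)
            (monic_X_pow_sub_C discAlgebraCoord two_ne_zero))) := by
  refine ⟨fun X _ _ _ _ A hA _ α hα hn hd t ht =>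
    isTopologicallyIsomorphicExtension_arensHoffman_cole hA hα hn hd ht, ?_⟩
  have : Nontrivial discAlgebra := ⟨0, discAlgebraCoord, fun h => by
    have h1 : (0 : ℂ) = 1 := congrArg (fun f : discAlgebra =>
      (f : C(Metric.closedBall (0 : ℂ) 1, ℂ)) ⟨1, by simp⟩) h
    exact zero_ne_one h1⟩
  have hdiscr := discr_X_sq_sub_C discAlgebraCoord
  have hd : ¬ IsTopologicalZeroDivisor (X ^ 2 - C discAlgebraCoord).discr := by
    rw [hdiscr]
    exact not_isTopologicalZeroDivisor_four_mul_discAlgebraCoord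
  refine ⟨isUniformAlgebra_discAlgebra, isNatural_discAlgebra, hdiscr, hd, fun t ht => ?_⟩
  refine isTopologicallyIsomorphicExtension_arensHoffman_cole isUniformAlgebra_discAlgebra
    (monic_X_pow_sub_C discAlgebraCoord two_ne_zero) ?_ hd ht
  rw [natDegree_X_pow_sub_C]
  exact two_pos
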